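/- Let $p$ be a prime number and let $(R,\mathfrak m)$ be a complete local Noetherian domain of mixed characteristic $p$ (that is, $R$ has characteristic $0$ and $R/pR$ has characteristic $p$). Let $R^+$ denote the integral closure of $R$ in an algebraic closure of its field of fractions. For a rational $\epsilon=m/n>0$ in lowest terms, let $p^{\epsilon}\in R^+$ denote a root of $z^n=p^m$ (it is unique up to a unit of $R^+$). A system of parameters of a local ring $(A,\mathfrak n)$ is a sequence of $\dim A$ elements generating an ideal with radical $\mathfrak n$. A sequence $y_1,\dots,y_k$ is regular on a module $N$ if $(y_1,\dots,y_k)N\neq N$ and each $y_i$ is a nonzerodivisor on $N/(y_1,\dots,y_{i-1})N$. Let $p,x_2,\dots,x_d$ be a system of parameters of $R$, and let $B$ be an $R^+$-algebra such that 1. $(p,x_2,\dots,x_d)B\neq B$; 2. $x_2,\dots,x_d$ is a regular sequence on $B/pB$; 3. $p$ is not nilpotent in $B$, and the ideal $(0:_B p)$ is annihilated by $p^{\epsilon}$ for every rational $\epsilon>0$. Suppose that $p^{\epsilon}\notin(p,x_2,\dots,x_d)B$ for some rational $\epsilon>0$. Then there are an $R^+$-algebra $C$ that is a big Cohen–Macaulay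 $R^+$-algebra, in the sense that $\mathfrak mC\neq C$ and $p,x_2,\dots,x_d$ is a regular sequence on $C$, and a homomorphism $B\to C$ of $R^+$-algebras. Moreover, the Monomial Conjecture holds for every local ring $T$ with $R\subseteq T\subseteq R^+$ (every ring $T$ between $R$ and $R^+$ is in fact local): for every system of parameters $y_1,\dots,y_d$ of $T$ and every integer $t\ge 0$, $$y_1^t\cdots y_d^t\notin(y_1^{t+1},\dots,y_d^{t+1})T.$$ -/

import Mathlib

universe u v

/-- The absolute integral closure `R⁺` of an integral domain `R`: the integral closure of `R` in an
algebraic closure of its field of fractions. -/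
abbrev AbsoluteIntegralClosure (R : Type*) [CommRing R] [IsDomain R] : Type _ :=
  integralClosure R (AlgebraicClosure (FractionRing R))

/-- A domain `A` has mixed characteristic `p > 0` if `A` has characteristic zero while `A / pA`
has characteristic `p`; here `p` is a prime number. -/
structure HasMixedCharacteristic (A : Type*) [CommRing A] (p : ℕ) : Prop where
  prime : p.Prime
  charZero : CharZero A
  charP : CharP (A ⧸ Ideal.span {(p : A)}) p

/-- `x 0, …, x (d - 1)` is a system of parameters of the local ring `A`: their number is the Krull
dimension of `A`, and the ideal they generate has the maximal ideal as its radical (for Noetherian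
`A` this says that it is primary to the maximal ideal). -/
structure IsSystemOfParameters {A : Type*} [CommRing A] [IsLocalRing A] {d : ℕ}
    (x : Fin d → A) : Prop where
  dim_eq : ringKrullDim A = d
  radical_eq : (Ideal.span (Set.range x)).radical = IsLocalRing.maximalIdeal A

/-- The structure map `R → R⁺ → B` of an `R⁺`-algebra `B`. -/
noncomputable def plusStructureMap (R : Type*) [CommRing R] [IsDomain R] (B : Type*) [CommRing B]
    [Algebra (AbsoluteIntegralClosure R) B] : R →+* B :=
  (algebraMap (AbsoluteIntegralClosure R) B).comp (algebraMap R (AbsoluteIntegralClosure R))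

/-- `r` is a (choice of the) power `a ^ ε`, for a rational number `ε > 0`: if `ε = m / n` in lowest
terms, then `r ^ n = a ^ m`. In `R⁺` such an `r` exists, and it is unique up to a unit. -/
def IsRationalPower {A : Type*} [CommRing A] (a : A) (ε : ℚ) (r : A) : Prop :=
  r ^ ε.den = a ^ ε.num.toNat

/-- The `R⁺`-algebra `C` is a big Cohen–Macaulay `R⁺`-algebra, with respect to the system of
parameters `x` of the local domain `R`: `𝔪 C ≠ C`, and `x` is a `C`-regular sequence. -/
structure IsBigCohenMacaulay {R : Type*} [CommRing R] [IsDomain R] [IsLocalRing R] {d : ℕ}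
    (x : Fin d → R) (C : Type*) [CommRing C] [Algebra (AbsoluteIntegralClosure R) C] : Prop where
  isSystemOfParameters : IsSystemOfParameters x
  map_maximalIdeal_ne_top :
    (IsLocalRing.maximalIdeal R).map (plusStructureMap R C) ≠ ⊤
  isRegular :
    RingTheory.Sequence.IsRegular C (List.ofFn fun i => plusStructureMap R C (x i))

/-- The assertion of the Monomial Conjecture for the local ring `A`: for every system of parameters
`x₁, …, x_d` of `A` and every `t`, one has `x₁ᵗ ⋯ x_dᵗ ∉ (x₁ᵗ⁺¹, …, x_dᵗ⁺¹)`. -/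
def MonomialConjectureHolds (A : Type*) [CommRing A] [IsLocalRing A] : Prop :=
  ∀ (d : ℕ) (x : Fin d → A), IsSystemOfParameters x →
    ∀ t : ℕ, ∏ i, x i ^ t ∉ Ideal.span (Set.range fun i => x i ^ (t + 1))

/-!
The two assertions have independent proofs.

*The algebra `C`.* Put `c = (p, p^{1/2}, p^{1/3}, …)`, an element of the ring `B^ℕ` of sequences,
and let `C = B^ℕ[1/c]` (`GabberLocalization`). The hypotheses say that each colon
`((p, x₂, …, xᵢ) : xᵢ₊₁)` of `B` is carried into `(p, x₂, …, xᵢ)` by every `p^ε`: for `p` itself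
this is the condition on `(0 : p)`, and afterwards `x₂, …, x_d` is even regular modulo `p`. Inverting `c`
therefore makes the sequence regular on `C` (`GabberLocalization.isRegular`). If `(p, x₂, …, x_d)C`
were `C`, then some power `c^k` would lie in `(p, x₂, …, x_d)B^ℕ`, so that `p^{k/n}` would lie in
`(p, x₂, …, x_d)B` for all `n`; as `R⁺` is integrally closed, `p^{k/n}` divides `p^ε` for large `n`
(`AbsoluteIntegralClosure.exists_pow_dvd`), which contradicts `p^ε ∉ (p, x₂, …, x_d)B`.

*The Monomial Conjecture.* A violating relation in `T` involves finitely many elements, so it lives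
in a module-finite extension `A` of `R` inside `T`, which is Noetherian and local. Some system of
parameters of `A` is regular on the `A`-module `C`, but regular sequences on `C` need not be
permutable. Dually, the sequence is coregular on the character module of `C`
(`RingTheory.Sequence.IsWeaklyRegular.isCoregular`), and one may pass to a power torsion submodule
`E` (`IsCoregular.exists_isPowTorsion`). On `E` coregular sequences are permutable
(`IsCoregular.perm`), and the last element of a system of parameters can be exchanged
(`IsCoregular.exchange`); by prime avoidance and Krull's principal ideal theorem any two systems of
parameters are joined by such exchanges, so that all of them are coregular on `E`
(`IsCoregular.of_generatesPrimary`). Now take `e ≠ 0` in `E` killed by `y₁, …, y_d`. Applying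
coregularity to systems of parameters of the form `y₁ᵗ⁺¹, …, yᵢ₋₁ᵗ⁺¹, yᵢ₊₁, …, y_d, yᵢ`, one finds
`f` killed by all `yᵢᵗ⁺¹` with `e = y₁ᵗ ⋯ y_dᵗ f` (`exists_prod_pow_smul_eq`). A relation
`y₁ᵗ ⋯ y_dᵗ ∈ (y₁ᵗ⁺¹, …, y_dᵗ⁺¹)` would give `e = 0`.
-/

/-! ### Coregular sequences -/

section Coregular

variable {A : Type*} [CommRing A] {N : Type*} [AddCommGroup N] [Module A N]

/-- The list `l` is a coregular sequence on the submodule `E` of `N`: its first element `a` acts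
surjectively on `E`, the second one on the kernel `E ∩ (0 : a)`, and so on. This is the Matlis dual
of a (weakly) regular sequence. -/
def IsCoregular : List A → Submodule A N → Prop
  | [], _ => True
  | a :: l, E => (∀ e ∈ E, ∃ e' ∈ E, a • e' = e) ∧ IsCoregular l (E ⊓ Submodule.torsionBy A N a)

/-- Every element of `E` is killed by a power of `a`. -/
def IsPowTorsion (a : A) (E : Submodule A N) : Prop :=
  ∀ e ∈ E, ∃ k : ℕ, a ^ k • e = 0

lemma IsPowTorsion.mono {a : A} {E F : Submodule A N} (h : IsPowTorsion a E) (hF : F ≤ E) :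
    IsPowTorsion a F := fun e he => h e (hF he)

lemma mem_inf_torsionBy {E : Submodule A N} {a : A} {e : N} :
    e ∈ E ⊓ Submodule.torsionBy A N a ↔ e ∈ E ∧ a • e = 0 := by
  rw [Submodule.mem_inf, Submodule.mem_torsionBy_iff]

lemma inf_torsionBy_right_comm (E : Submodule A N) (a b : A) :
    E ⊓ Submodule.torsionBy A N a ⊓ Submodule.torsionBy A N b =
      E ⊓ Submodule.torsionBy A N b ⊓ Submodule.torsionBy A N a :=
  inf_right_comm _ _ _

/-- If `a` acts surjectively on `E` and `b` on `E ∩ (0 : a)`, then `b` acts surjectively on `E`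
provided that `E` is `a`-power torsion: `a` is injective on the `a`-power torsion module `E / bE`,
which therefore vanishes. -/
lemma IsPowTorsion.surjective_of_swap {E : Submodule A N} {a b : A} (ht : IsPowTorsion a E)
    (ha : ∀ e ∈ E, ∃ e' ∈ E, a • e' = e)
    (hb : ∀ e ∈ E ⊓ Submodule.torsionBy A N a, ∃ e' ∈ E ⊓ Submodule.torsionBy A N a, b • e' = e) :
    ∀ e ∈ E, ∃ e' ∈ E, b • e' = e := by
  have key : ∀ k : ℕ, ∀ e ∈ E, a ^ k • e = 0 → ∃ e' ∈ E, b • e' = e := by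
    intro k
    induction k with
    | zero =>
      intro e _ h0
      exact ⟨0, E.zero_mem, by simpa using h0.symm⟩
    | succ k ih =>
      intro e he hk
      obtain ⟨f, hf, hfe⟩ := ih (a • e) (E.smul_mem a he) (by rw [← mul_smul, ← pow_succ, hk])
      obtain ⟨g, hg, rfl⟩ := ha f hf
      obtain ⟨h, hh, hhe⟩ := hb (e - b • g) (mem_inf_torsionBy.2
        ⟨E.sub_mem he (E.smul_mem b hg), by rw [smul_sub, ← hfe, smul_comm, sub_self]⟩)
      exact ⟨g + h, E.add_mem hg (mem_inf_torsionBy.1 hh).1, by rw [smul_add, hhe]; abel⟩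
  intro e he
  obtain ⟨k, hk⟩ := ht e he
  exact key k e he hk

lemma IsCoregular.swap {E : Submodule A N} {a b : A} {l : List A} (ht : IsPowTorsion a E)
    (h : IsCoregular (a :: b :: l) E) : IsCoregular (b :: a :: l) E := by
  obtain ⟨ha, hb, hl⟩ := h
  refine ⟨ht.surjective_of_swap ha hb, ?_, by rwa [inf_torsionBy_right_comm]⟩
  intro e he
  obtain ⟨f, hf, rfl⟩ := ha e (mem_inf_torsionBy.1 he).1
  have hbf : a • b • f = 0 := by rw [smul_comm]; exact (mem_inf_torsionBy.1 he).2
  obtain ⟨g, hg, hgf⟩ := hb (b • f) (mem_inf_torsionBy.2 ⟨E.smul_mem b hf, hbf⟩)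
  refine ⟨f - g, mem_inf_torsionBy.2 ⟨E.sub_mem hf (mem_inf_torsionBy.1 hg).1, ?_⟩, ?_⟩
  · rw [smul_sub, hgf, sub_self]
  · rw [smul_sub, (mem_inf_torsionBy.1 hg).2, sub_zero]

/-- Over a module which is power torsion for all elements involved, coregular sequences may be
permuted. -/
lemma IsCoregular.perm {l l' : List A} (hp : l.Perm l') :
    ∀ {E : Submodule A N}, (∀ a ∈ l, IsPowTorsion a E) → IsCoregular l E → IsCoregular l' E := by
  induction hp with
  | nil => exact fun _ h => h
  | cons a _ ih =>
    intro E ht h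
    exact ⟨h.1, ih (fun b hb => (ht b (List.mem_cons_of_mem _ hb)).mono inf_le_left) h.2⟩
  | swap a b l =>
    intro E ht h
    exact h.swap (ht _ (by simp))
  | trans h₁ _ ih₁ ih₂ =>
    intro E ht h
    exact ih₂ (fun a ha => ht a (h₁.mem_iff.2 ha)) (ih₁ ht h)

lemma IsCoregular.rotate {a : A} {l : List A} :
    ∀ {E : Submodule A N}, IsPowTorsion a E → IsCoregular (a :: l) E →
      IsCoregular (l ++ [a]) E := by
  induction l with
  | nil => exact fun _ h => h
  | cons b l ih =>
    intro E ht h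
    have h' := h.swap ht
    exact ⟨h'.1, ih (ht.mono inf_le_left) h'.2⟩

/-- The submodule of the elements of `E` killed by a power of `a`. -/
def powTorsionPart (a : A) (E : Submodule A N) : Submodule A N where
  carrier := {e | e ∈ E ∧ ∃ k : ℕ, a ^ k • e = 0}
  zero_mem' := ⟨E.zero_mem, 0, smul_zero _⟩
  add_mem' := by
    rintro e f ⟨he, k, hk⟩ ⟨hf, j, hj⟩
    refine ⟨E.add_mem he hf, k + j, ?_⟩
    rw [smul_add, pow_add, mul_smul _ _ f, hj, mul_comm, mul_smul, hk]
    simp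
  smul_mem' := by
    rintro c e ⟨he, k, hk⟩
    exact ⟨E.smul_mem c he, k, by rw [smul_comm, hk, smul_zero]⟩

lemma mem_powTorsionPart {a : A} {E : Submodule A N} {e : N} :
    e ∈ powTorsionPart a E ↔ e ∈ E ∧ ∃ k : ℕ, a ^ k • e = 0 := Iff.rfl

lemma IsCoregular.on_powTorsionPart {a : A} {l : List A} {E : Submodule A N}
    (h : IsCoregular (a :: l) E) : IsCoregular (a :: l) (powTorsionPart a E) := by
  refine ⟨?_, ?_⟩
  · rintro e ⟨he, k, hk⟩
    obtain ⟨f, hf, rfl⟩ := h.1 e he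
    exact ⟨f, ⟨hf, k + 1, by rw [pow_succ, mul_smul, hk]⟩, rfl⟩
  · have : powTorsionPart a E ⊓ Submodule.torsionBy A N a =
        E ⊓ Submodule.torsionBy A N a := by
      ext e
      simp only [mem_inf_torsionBy, mem_powTorsionPart]
      exact ⟨fun h => ⟨h.1.1, h.2⟩, fun h => ⟨⟨h.1, 1, by simpa using h.2⟩, h.2⟩⟩
    rw [this]
    exact h.2

/-- Coregularity survives the passage to power torsion. One element is treated at a time: it is then
moved to the end of the sequence, which only needs power torsion for that element. -/
lemma IsCoregular.exists_isPowTorsion_append {e : N} (l : List A) :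
    ∀ (l' : List A) (E : Submodule A N), IsCoregular (l ++ l') E → (∀ a ∈ l', IsPowTorsion a E) →
      e ∈ E → (∀ a ∈ l, a • e = 0) →
      ∃ F : Submodule A N, IsCoregular (l' ++ l) F ∧ (∀ a ∈ l' ++ l, IsPowTorsion a F) ∧ e ∈ F := by
  induction l with
  | nil =>
    intro l' E h ht he _
    exact ⟨E, by simpa using h, by simpa using ht, he⟩
  | cons a l ih =>
    intro l' E h ht he hl
    have hle : powTorsionPart a E ≤ E := fun _ h => h.1
    have hta : IsPowTorsion a (powTorsionPart a E) := fun _ h => h.2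
    obtain ⟨F, h₁, h₂, h₃⟩ := ih (l' ++ [a]) (powTorsionPart a E)
      (by simpa using IsCoregular.rotate hta h.on_powTorsionPart)
      (by
        intro b hb
        rcases List.mem_append.1 hb with hb | hb
        · exact (ht b hb).mono hle
        · rw [List.mem_singleton.1 hb]; exact hta)
      ⟨he, 1, by simpa using hl a (by simp)⟩ (fun b hb => hl b (by simp [hb]))
    exact ⟨F, by simpa using h₁, by simpa using h₂, h₃⟩

lemma IsCoregular.exists_isPowTorsion {e : N} {l : List A} {E : Submodule A N}
    (h : IsCoregular l E) (he : e ∈ E) (hl : ∀ a ∈ l, a • e = 0) :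
    ∃ F : Submodule A N, IsCoregular l F ∧ (∀ a ∈ l, IsPowTorsion a F) ∧ e ∈ F := by
  simpa using IsCoregular.exists_isPowTorsion_append l [] E (by simpa using h) (by simp) he hl

lemma isCoregular_append_singleton_iff {b : A} {l : List A} :
    ∀ {E : Submodule A N}, IsCoregular (l ++ [b]) E ↔ IsCoregular l E ∧
      ∀ e ∈ E, (∀ a ∈ l, a • e = 0) → ∃ e' ∈ E, (∀ a ∈ l, a • e' = 0) ∧ b • e' = e := by
  induction l with
  | nil => intro E; simp [IsCoregular]
  | cons a l ih =>
    intro E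
    simp only [List.cons_append, IsCoregular, ih, mem_inf_torsionBy, List.forall_mem_cons]
    constructor
    · rintro ⟨h₁, h₂, h₃⟩
      refine ⟨⟨h₁, h₂⟩, fun e he h => ?_⟩
      obtain ⟨f, hf, h'⟩ := h₃ e ⟨he, h.1⟩ h.2
      exact ⟨f, hf.1, ⟨hf.2, h'.1⟩, h'.2⟩
    · rintro ⟨⟨h₁, h₂⟩, h₃⟩
      refine ⟨h₁, h₂, fun e he h => ?_⟩
      obtain ⟨f, hf, h', h''⟩ := h₃ e he.1 ⟨he.2, h⟩
      exact ⟨f, ⟨hf, h'.1⟩, h'.2, h''⟩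

lemma smul_eq_zero_of_mem_ofList {l : List A} {c : A} {e : N} (hc : c ∈ Ideal.ofList l)
    (hl : ∀ a ∈ l, a • e = 0) : c • e = 0 := by
  have : Ideal.ofList l ≤ Ideal.torsionOf A N e :=
    Ideal.span_le.2 fun a ha => (Ideal.mem_torsionOf_iff _ _).2 (hl a ha)
  exact (Ideal.mem_torsionOf_iff _ _).1 (this hc)

/-- The last element `b` of a coregular sequence may be replaced by any `w` such that a power of `b`
lies in the ideal generated by `w` and the other elements. -/
lemma IsCoregular.exchange {l : List A} {b w : A} {k : ℕ} {E : Submodule A N}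
    (h : IsCoregular (l ++ [b]) E) (hw : b ^ k ∈ Ideal.ofList (l ++ [w])) :
    IsCoregular (l ++ [w]) E := by
  rw [isCoregular_append_singleton_iff] at h ⊢
  refine ⟨h.1, fun e he hl => ?_⟩
  have hpow : ∀ j : ℕ, ∃ e' ∈ E, (∀ a ∈ l, a • e' = 0) ∧ b ^ j • e' = e := by
    intro j
    induction j with
    | zero => exact ⟨e, he, hl, by simp⟩
    | succ j ih =>
      obtain ⟨f, hf, hfl, hfe⟩ := ih
      obtain ⟨g, hg, hgl, hgf⟩ := h.2 f hf hfl
      exact ⟨g, hg, hgl, by rw [pow_succ, mul_smul, hgf, hfe]⟩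
  obtain ⟨f, hf, hfl, hfe⟩ := hpow k
  rw [Ideal.ofList_append, Ideal.ofList_singleton, Submodule.mem_sup] at hw
  obtain ⟨y, hy, z, hz, hyz⟩ := hw
  obtain ⟨u, rfl⟩ := Ideal.mem_span_singleton'.1 hz
  refine ⟨u • f, E.smul_mem u hf, fun a ha => by rw [smul_comm, hfl a ha, smul_zero], ?_⟩
  rw [← hfe, ← hyz, add_smul, smul_eq_zero_of_mem_ofList hy hfl, zero_add, mul_comm, mul_smul]

end Coregular

/-! ### The character module of a module with a regular sequence -/

section Dual

variable {A : Type*} [CommRing A] {M : Type*} [AddCommGroup M] [Module A M]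

/-- The characters of `M` that vanish on the submodule `P`. -/
def characterAnnihilator (P : Submodule A M) : Submodule A (CharacterModule M) where
  carrier := {f | ∀ m ∈ P, f m = 0}
  zero_mem' := fun _ _ => rfl
  add_mem' := fun {f g} hf hg m hm => by
    change f m + g m = 0
    rw [hf m hm, hg m hm, add_zero]
  smul_mem' := fun c f hf m hm => hf _ (P.smul_mem c hm)

open scoped Pointwise in
lemma characterAnnihilator_inf_torsionBy (P : Submodule A M) (a : A) :
    characterAnnihilator P ⊓ Submodule.torsionBy A (CharacterModule M) a =
      characterAnnihilator (P ⊔ a • ⊤) := by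
  ext f
  rw [mem_inf_torsionBy]
  constructor
  · rintro ⟨h₁, h₂⟩ m hm
    obtain ⟨y, hy, z, hz, rfl⟩ := Submodule.mem_sup.1 hm
    obtain ⟨z, -, rfl⟩ := (Submodule.mem_smul_pointwise_iff_exists _ _ _).1 hz
    rw [map_add, h₁ y hy, zero_add]
    exact DFunLike.congr_fun h₂ z
  · intro h
    refine ⟨fun m hm => h m (Submodule.mem_sup_left hm), CharacterModule.ext _ fun m => ?_⟩
    exact h _ (Submodule.mem_sup_right ((Submodule.mem_smul_pointwise_iff_exists _ _ _).2
      ⟨m, trivial, rfl⟩))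

lemma exists_smul_eq_of_isSMulRegular {P : Submodule A M} {a : A}
    (h : IsSMulRegular (M ⧸ P) a) :
    ∀ f ∈ characterAnnihilator P, ∃ g ∈ characterAnnihilator P, a • g = f := by
  intro f hf
  have hfP : P.toAddSubgroup ≤ AddMonoidHom.ker f := fun m hm => hf m hm
  let f' : CharacterModule (M ⧸ P) := QuotientAddGroup.lift P.toAddSubgroup f hfP
  obtain ⟨g', hg'⟩ := CharacterModule.dual_surjective_of_injective
    (LinearMap.lsmul A (M ⧸ P) a) h f'
  refine ⟨CharacterModule.dual P.mkQ g', fun m hm => ?_, CharacterModule.ext _ fun m => ?_⟩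
  · change g' (P.mkQ m) = 0
    rw [(Submodule.Quotient.mk_eq_zero P).2 hm |> fun h => (h : P.mkQ m = 0), map_zero]
  · exact DFunLike.congr_fun hg' (P.mkQ m)

/-- A weakly regular sequence on `M` is coregular on the character module of `M`. -/
lemma RingTheory.Sequence.IsWeaklyRegular.isCoregular {l : List A}
    (h : RingTheory.Sequence.IsWeaklyRegular M l) :
    IsCoregular l (⊤ : Submodule A (CharacterModule M)) := by
  have key : ∀ (l l' : List A), RingTheory.Sequence.IsWeaklyRegular M (l' ++ l) →
      IsCoregular l (characterAnnihilator (Ideal.ofList l' • ⊤ : Submodule A M)) := by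
    intro l
    induction l with
    | nil => exact fun _ _ => trivial
    | cons a l ih =>
      intro l' h
      refine ⟨exists_smul_eq_of_isSMulRegular ?_, ?_⟩
      · have h₁ := h.regular_mod_prev l'.length (by simp)
        have h₂ : (l' ++ a :: l)[l'.length]'(by simp) = a := by simp
        rwa [List.take_left, h₂] at h₁
      · rw [characterAnnihilator_inf_torsionBy, ← Submodule.ideal_span_singleton_smul,
          ← Submodule.sup_smul, ← Ideal.ofList_singleton, ← Ideal.ofList_append]
        exact ih _ (by simpa using h)
  have h' := key l [] h
  rwa [Ideal.ofList_nil, Submodule.bot_smul,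
    show characterAnnihilator (⊥ : Submodule A M) = ⊤ from
      eq_top_iff.2 fun f _ m hm => by rw [(Submodule.mem_bot A).1 hm, map_zero]] at h'

/-- If `M ≠ (l)M`, then some nonzero character of `M` is killed by all the elements of `l`. -/
lemma exists_character_ne_zero {l : List A} (h : (⊤ : Submodule A M) ≠ Ideal.ofList l • ⊤) :
    ∃ f : CharacterModule M, f ≠ 0 ∧ ∀ a ∈ l, a • f = 0 := by
  obtain ⟨m, hm⟩ : ∃ m : M, m ∉ (Ideal.ofList l • ⊤ : Submodule A M) := by
    by_contra! hc
    exact h (eq_top_iff.2 fun m _ => hc m).symm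
  obtain ⟨c, hc⟩ := CharacterModule.exists_character_apply_ne_zero_of_ne_zero
    (a := (Ideal.ofList l • ⊤ : Submodule A M).mkQ m) (by simpa using hm)
  refine ⟨CharacterModule.dual (Submodule.mkQ _) c, fun h0 => hc (DFunLike.congr_fun h0 m), ?_⟩
  intro a ha
  refine CharacterModule.ext _ fun y => ?_
  change c (Submodule.mkQ _ (a • y)) = 0
  have : Submodule.mkQ (Ideal.ofList l • ⊤ : Submodule A M) (a • y) = 0 := by
    rw [Submodule.mkQ_apply, Submodule.Quotient.mk_eq_zero]
    exact Submodule.smul_mem_smul (Ideal.subset_span ha) trivial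
  rw [this, map_zero]

end Dual

/-! ### Exchanging systems of parameters -/

section Parameters

variable {A : Type*} [CommRing A] [IsLocalRing A]

open IsLocalRing

/-- The elements of `l` generate an ideal that is primary to the maximal ideal; this is expressed
through the prime ideals containing `l`, which makes it visibly independent of the order of `l` and
of the exponents of its elements. -/
structure GeneratesPrimary (l : List A) : Prop where
  mem : ∀ a ∈ l, a ∈ maximalIdeal A
  eq_of_mem : ∀ P : Ideal A, P.IsPrime → (∀ a ∈ l, a ∈ P) → P = maximalIdeal A

lemma GeneratesPrimary.perm {l l' : List A} (h : GeneratesPrimary l) (hp : l.Perm l') :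
    GeneratesPrimary l' where
  mem a ha := h.mem a (hp.mem_iff.2 ha)
  eq_of_mem P hP hl := h.eq_of_mem P hP fun a ha => hl a (hp.mem_iff.1 ha)

lemma GeneratesPrimary.exists_pow_mem {l : List A} (h : GeneratesPrimary l) {I : Ideal A}
    (hI : ∀ a ∈ l, a ∈ I) {a : A} (ha : a ∈ maximalIdeal A) : ∃ k : ℕ, a ^ k ∈ I := by
  change a ∈ I.radical
  rw [Ideal.radical_eq_sInf, Ideal.mem_sInf]
  rintro P ⟨hIP, hP⟩
  rwa [h.eq_of_mem P hP fun b hb => hIP (hI b hb)]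

lemma GeneratesPrimary.isPowTorsion {N : Type*} [AddCommGroup N] [Module A N] {l : List A}
    (h : GeneratesPrimary l) {E : Submodule A N} (hl : ∀ a ∈ l, IsPowTorsion a E) {a : A}
    (ha : a ∈ maximalIdeal A) : IsPowTorsion a E := by
  intro e he
  suffices a ∈ (Ideal.torsionOf A N e).radical from this
  rw [Ideal.radical_eq_sInf, Ideal.mem_sInf]
  rintro P ⟨hIP, hP⟩
  rw [h.eq_of_mem P hP]
  · exact ha
  · intro b hb
    obtain ⟨k, hk⟩ := hl b hb e he
    exact hP.mem_of_pow_mem k (hIP ((Ideal.mem_torsionOf_iff _ _).2 hk))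

variable [IsNoetherianRing A]

lemma ne_maximalIdeal_of_mem_minimalPrimes {l : List A} (hl : l.length < (maximalIdeal A).height)
    {Q : Ideal A} (hQ : Q ∈ (Ideal.ofList l).minimalPrimes) : Q ≠ maximalIdeal A := by
  classical
  rintro rfl
  refine absurd hl (not_lt.2 ?_)
  have h := Ideal.height_le_card_of_mem_minimalPrimes_span (s := {a | a ∈ l})
    (List.finite_toSet l) hQ
  refine h.trans ?_
  have : ({a | a ∈ l} : Set A) = (l.toFinset : Set A) := by ext; simp
  rw [this, Set.ncard_coe_finset]
  exact_mod_cast l.toFinset_card_le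

/-- Prime avoidance: a common last parameter for two sequences that are too short to be systems of
parameters. -/
lemma exists_mem_maximalIdeal_notMem_minimalPrimes {l l' : List A}
    (hl : l.length < (maximalIdeal A).height) (hl' : l'.length < (maximalIdeal A).height) :
    ∃ w ∈ maximalIdeal A, (∀ Q ∈ (Ideal.ofList l).minimalPrimes, w ∉ Q) ∧
      ∀ Q ∈ (Ideal.ofList l').minimalPrimes, w ∉ Q := by
  by_contra! hc
  have hfin : ((Ideal.ofList l).minimalPrimes ∪ (Ideal.ofList l').minimalPrimes).Finite :=
    (Ideal.finite_minimalPrimes_of_isNoetherianRing A _).union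
      (Ideal.finite_minimalPrimes_of_isNoetherianRing A _)
  have hsub : ((maximalIdeal A : Ideal A) : Set A) ⊆
      ⋃ Q ∈ ((Ideal.ofList l).minimalPrimes ∪ (Ideal.ofList l').minimalPrimes), (Q : Set A) := by
    intro w hw
    simp only [Set.mem_iUnion]
    by_cases h : ∀ Q ∈ (Ideal.ofList l).minimalPrimes, w ∉ Q
    · obtain ⟨Q, hQ, hwQ⟩ := hc w hw h
      exact ⟨Q, Or.inr hQ, hwQ⟩
    · push Not at h
      obtain ⟨Q, hQ, hwQ⟩ := h
      exact ⟨Q, Or.inl hQ, hwQ⟩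
  obtain ⟨Q, hQ, hle⟩ := (Ideal.subset_union_prime_finite hfin (f := id) ⊥ ⊥ (by
    rintro Q (hQ | hQ) _ _ <;> exact hQ.1.1)).1 hsub
  rcases hQ with hQ | hQ
  · exact ne_maximalIdeal_of_mem_minimalPrimes hl hQ
      (((maximalIdeal.isMaximal A).eq_of_le hQ.1.1.ne_top hle).symm)
  · exact ne_maximalIdeal_of_mem_minimalPrimes hl' hQ
      (((maximalIdeal.isMaximal A).eq_of_le hQ.1.1.ne_top hle).symm)

/-- If `l, b` generate an `𝔪`-primary ideal, then `b` may be replaced by any element of `𝔪` outside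
of the minimal primes of `l`: by Krull's principal ideal theorem, `A / Q` has dimension at most one
for such a minimal prime `Q`. -/
lemma GeneratesPrimary.replace_last {l : List A} {b w : A} (h : GeneratesPrimary (l ++ [b]))
    (hw : w ∈ maximalIdeal A) (hwl : ∀ Q ∈ (Ideal.ofList l).minimalPrimes, w ∉ Q) :
    GeneratesPrimary (l ++ [w]) where
  mem a ha := by
    rcases List.mem_append.1 ha with ha | ha
    · exact h.mem a (List.mem_append_left _ ha)
    · rwa [List.mem_singleton.1 ha]
  eq_of_mem P hP hPl := by
    obtain ⟨Q, hQ, hQP⟩ := Ideal.exists_minimalPrimes_le (I := Ideal.ofList l) (J := P)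
      (Ideal.span_le.2 fun a ha => hPl a (List.mem_append_left _ ha))
    have hQprime : Q.IsPrime := hQ.1.1
    have hPm : P ≤ maximalIdeal A := le_maximalIdeal hP.ne_top
    have hQm : Q ≤ maximalIdeal A := hQP.trans hPm
    by_contra hne
    -- Otherwise `Q < P < 𝔪`, while `𝔪` is minimal over `Q + (b)`, so of height `≤ 1` modulo `Q`.
    have hmin : maximalIdeal A ∈ (Q ⊔ Ideal.span {b}).minimalPrimes := by
      refine ⟨⟨inferInstance, sup_le hQm ?_⟩, ?_⟩
      · rw [Ideal.span_singleton_le_iff_mem]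
        exact h.mem b (by simp)
      · rintro P' ⟨hP', hle⟩ -
        refine (h.eq_of_mem P' hP' fun a ha => ?_).ge
        rcases List.mem_append.1 ha with ha | ha
        · exact hle (Ideal.mem_sup_left (hQ.1.2 (Ideal.subset_span ha)))
        · rw [List.mem_singleton.1 ha]
          exact hle (Ideal.mem_sup_right (Ideal.mem_span_singleton_self b))
    have hheight := Ideal.map_height_le_one_of_mem_minimalPrimes hmin
    have hPp : (P.map (Ideal.Quotient.mk Q)).IsPrime := Ideal.isPrime_map_quotientMk_of_isPrime hQP
    have h₁ : (⊥ : Ideal (A ⧸ Q)) < P.map (Ideal.Quotient.mk Q) := by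
      rw [bot_lt_iff_ne_bot, Ne, Ideal.map_eq_bot_iff_le_ker, Ideal.mk_ker]
      exact fun hle => hwl Q hQ (hle (hPl w (by simp)))
    have h₂ : P.map (Ideal.Quotient.mk Q) < (maximalIdeal A).map (Ideal.Quotient.mk Q) := by
      refine lt_of_le_of_ne (Ideal.map_mono hPm) fun heq => hne ?_
      have := congrArg (Ideal.comap (Ideal.Quotient.mk Q)) heq
      rwa [Ideal.comap_map_mk hQP, Ideal.comap_map_mk hQm] at this
    have h₃ := (Ideal.height_strict_mono_of_isPrime h₂).trans_le hheight
    have h₄ := Ideal.height_strict_mono_of_isPrime h₁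
    exact absurd (Order.lt_one_iff.1 h₃ ▸ h₄) not_lt_zero

/-- On a torsion module, coregularity passes from one system of parameters to any other: the two
can be joined by a chain in which one element is exchanged at a time. -/
lemma IsCoregular.of_generatesPrimary_append {N : Type*} [AddCommGroup N] [Module A N]
    {E : Submodule A N} (ht : ∀ a ∈ maximalIdeal A, IsPowTorsion a E) (j : ℕ) :
    ∀ ws xs ys : List A, xs.length = j → ys.length = j →
      (ws.length + j : ℕ) = (maximalIdeal A).height →
      GeneratesPrimary (ws ++ xs) → GeneratesPrimary (ws ++ ys) →
      IsCoregular (ws ++ xs) E → IsCoregular (ws ++ ys) E := by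
  have hperm : ∀ {l l' : List A}, l.Perm l' → GeneratesPrimary l → IsCoregular l E →
      IsCoregular l' E := fun hp hl h => h.perm hp fun a ha => ht a (hl.mem a ha)
  induction j with
  | zero =>
    intro ws xs ys hxs hys _ _ _ h
    rw [List.length_eq_zero_iff] at hxs hys
    rwa [hys, ← hxs]
  | succ j ih =>
    intro ws xs ys hxs hys hd hX hY h
    obtain ⟨x, xs, rfl⟩ := List.exists_cons_of_length_eq_add_one hxs
    obtain ⟨y, ys, rfl⟩ := List.exists_cons_of_length_eq_add_one hys
    rw [List.length_cons, Nat.add_right_cancel_iff] at hxs hys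
    have hmove : ∀ (z : A) (zs : List A), (ws ++ z :: zs).Perm ((ws ++ zs) ++ [z]) := fun z zs =>
      List.perm_middle.trans (List.perm_append_singleton z (ws ++ zs)).symm
    have hmove' : ∀ (z : A) (zs : List A), ((ws ++ zs) ++ [z]).Perm ((z :: ws) ++ zs) :=
      fun z zs => List.perm_append_singleton z (ws ++ zs)
    have hlen : ∀ zs : List A, zs.length = j →
        ((ws ++ zs).length : ℕ∞) < (maximalIdeal A).height := by
      intro zs hzs
      rw [← hd, List.length_append, hzs]
      exact_mod_cast Nat.lt_succ_self _
    obtain ⟨w, hw, hwx, hwy⟩ :=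
      exists_mem_maximalIdeal_notMem_minimalPrimes (hlen xs hxs) (hlen ys hys)
    have hX' := hX.perm (hmove x xs)
    have hY' := hY.perm (hmove y ys)
    have hXw := hX'.replace_last hw hwx
    have hYw := hY'.replace_last hw hwy
    obtain ⟨k, hk⟩ := hXw.exists_pow_mem (I := Ideal.ofList ((ws ++ xs) ++ [w]))
      (fun a ha => Ideal.subset_span ha) (hX.mem x (by simp))
    obtain ⟨k', hk'⟩ := hY'.exists_pow_mem (I := Ideal.ofList ((ws ++ ys) ++ [y]))
      (fun a ha => Ideal.subset_span ha) hw
    have h₁ := (hperm (hmove x xs) hX h).exchange hk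
    have h₂ := ih (w :: ws) xs ys hxs hys (by rw [← hd]; simp; ring)
      (hXw.perm (hmove' w xs)) (hYw.perm (hmove' w ys)) (hperm (hmove' w xs) hXw h₁)
    have h₃ := (hperm (hmove' w ys).symm (hYw.perm (hmove' w ys)) h₂).exchange hk'
    exact hperm (hmove y ys).symm hY' h₃

lemma IsCoregular.of_generatesPrimary {N : Type*} [AddCommGroup N] [Module A N]
    {E : Submodule A N} (ht : ∀ a ∈ maximalIdeal A, IsPowTorsion a E) {l l' : List A}
    (hl : l.length = (maximalIdeal A).height) (hl' : l'.length = (maximalIdeal A).height)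
    (h : GeneratesPrimary l) (h' : GeneratesPrimary l') (hE : IsCoregular l E) :
    IsCoregular l' E := by
  have hlen : l'.length = l.length := by exact_mod_cast hl'.trans hl.symm
  exact IsCoregular.of_generatesPrimary_append ht l.length [] l l' rfl hlen (by simpa using hl)
    h h' hE

end Parameters

/-! ### The monomial property -/

section Monomial

variable {A : Type*} [CommRing A] {N : Type*} [AddCommGroup N] [Module A N]

lemma exists_ne_zero_forall_smul_eq_zero {E : Submodule A N} {l : List A}
    (ht : ∀ a ∈ l, IsPowTorsion a E) : ∀ e ∈ E, e ≠ 0 → ∃ f ∈ E, f ≠ 0 ∧ ∀ a ∈ l, a • f = 0 := by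
  classical
  induction l with
  | nil => exact fun e he h0 => ⟨e, he, h0, by simp⟩
  | cons a l ih =>
    intro e he h0
    obtain ⟨f, hf, hf0, hfl⟩ := ih (fun b hb => ht b (List.mem_cons_of_mem _ hb)) e he h0
    -- Multiply by the largest power of `a` that does not kill `f`.
    have hex := ht a (by simp) f hf
    obtain ⟨k, hk⟩ : ∃ k, Nat.find hex = k + 1 :=
      Nat.exists_eq_succ_of_ne_zero fun h => hf0 (by simpa [h] using Nat.find_spec hex)
    refine ⟨a ^ k • f, E.smul_mem _ hf, Nat.find_min hex (by lia), ?_⟩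
    rw [List.forall_mem_cons]
    refine ⟨?_, fun b hb => by rw [smul_comm, hfl b hb, smul_zero]⟩
    rw [← mul_smul, ← pow_succ', ← hk]
    exact Nat.find_spec hex

variable [IsLocalRing A]

open IsLocalRing

lemma GeneratesPrimary.map_pow_append {l l' : List A} {t : ℕ} (h : GeneratesPrimary (l ++ l')) :
    GeneratesPrimary (l.map (· ^ (t + 1)) ++ l') where
  mem a ha := by
    rcases List.mem_append.1 ha with ha | ha
    · obtain ⟨b, hb, rfl⟩ := List.mem_map.1 ha
      exact Ideal.pow_mem_of_mem _ (h.mem b (List.mem_append_left _ hb)) _ t.succ_pos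
    · exact h.mem a (List.mem_append_right _ ha)
  eq_of_mem P hP hPl := by
    refine h.eq_of_mem P hP fun a ha => ?_
    rcases List.mem_append.1 ha with ha | ha
    · exact hP.mem_of_pow_mem (t + 1)
        (hPl _ (List.mem_append_left _ (List.mem_map.2 ⟨a, ha, rfl⟩)))
    · exact hPl a (List.mem_append_right _ ha)

/-- If all systems of parameters are coregular on `E`, then every element of `E` killed by the
system of parameters `y₁, …, y_d` is of the form `y₁ᵗ ⋯ y_dᵗ • f` with `f` killed by all `yᵢᵗ⁺¹`. -/
lemma exists_prod_pow_smul_eq {E : Submodule A N} (d : ℕ)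
    (hE : ∀ l : List A, l.length = d → GeneratesPrimary l → IsCoregular l E) (t : ℕ)
    (l' : List A) : ∀ l : List A, l.length + l'.length = d → GeneratesPrimary (l ++ l') →
      ∀ e ∈ E, (∀ a ∈ l, a ^ (t + 1) • e = 0) → (∀ a ∈ l', a • e = 0) →
      ∃ f ∈ E, (∀ a ∈ l ++ l', a ^ (t + 1) • f = 0) ∧ (l'.map (· ^ t)).prod • f = e := by
  induction l' with
  | nil => exact fun l _ _ e he hl _ => ⟨e, he, by simpa using hl, by simp⟩
  | cons b l' ih =>
    intro l hd hp e he hl hl'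
    rw [List.forall_mem_cons] at hl'
    have hperm : (l.map (· ^ (t + 1)) ++ b :: l').Perm ((l.map (· ^ (t + 1)) ++ l') ++ [b]) :=
      List.perm_middle.trans (List.perm_append_singleton b _).symm
    have hco := hE _ (by simpa [add_assoc] using hd) (hp.map_pow_append (t := t) |>.perm hperm)
    rw [isCoregular_append_singleton_iff] at hco
    have hpow : ∀ j : ℕ, ∃ f ∈ E, (∀ a ∈ l.map (· ^ (t + 1)) ++ l', a • f = 0) ∧ b ^ j • f = e := by
      intro j
      induction j with
      | zero =>
        refine ⟨e, he, fun a ha => ?_, by simp⟩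
        rcases List.mem_append.1 ha with ha | ha
        · obtain ⟨c, hc, rfl⟩ := List.mem_map.1 ha
          exact hl c hc
        · exact hl'.2 a ha
      | succ j ih =>
        obtain ⟨f, hf, hfl, hfe⟩ := ih
        obtain ⟨g, hg, hgl, hgf⟩ := hco.2 f hf hfl
        exact ⟨g, hg, hgl, by rw [pow_succ, mul_smul, hgf, hfe]⟩
    obtain ⟨f, hf, hfl, hfe⟩ := hpow t
    obtain ⟨g, hg, hgl, hgf⟩ := ih (l ++ [b]) (by rw [← hd]; simp; ring)
      (by simpa using hp) f hf (by
        intro a ha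
        rcases List.mem_append.1 ha with ha | ha
        · exact hfl _ (List.mem_append_left _ (List.mem_map.2 ⟨a, ha, rfl⟩))
        · rw [List.mem_singleton.1 ha, pow_succ', mul_smul, hfe, hl'.1])
      (fun a ha => hfl a (List.mem_append_right _ ha))
    refine ⟨g, hg, by simpa using hgl, ?_⟩
    rw [List.map_cons, List.prod_cons, mul_smul, hgf, hfe]

/-- If some system of parameters of the Noetherian local ring `A` is a regular sequence on some
`A`-module, then every system of parameters of `A` satisfies the Monomial Conjecture. -/
theorem prod_pow_notMem_of_isRegular [IsNoetherianRing A] {M : Type*} [AddCommGroup M] [Module A M]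
    {l l' : List A} (hl : l.length = (maximalIdeal A).height)
    (hl' : l'.length = (maximalIdeal A).height) (h : GeneratesPrimary l) (h' : GeneratesPrimary l')
    (hM : RingTheory.Sequence.IsRegular M l) (t : ℕ) :
    (l'.map (· ^ t)).prod ∉ Ideal.ofList (l'.map (· ^ (t + 1))) := by
  intro hmem
  obtain ⟨e, he0, hel⟩ := exists_character_ne_zero hM.top_ne_smul
  obtain ⟨E, hE, hEl, heE⟩ := hM.toIsWeaklyRegular.isCoregular.exists_isPowTorsion
    (Submodule.mem_top (x := e)) hel
  have ht : ∀ a ∈ maximalIdeal A, IsPowTorsion a E := fun a ha => h.isPowTorsion hEl ha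
  obtain ⟨f, hf, hf0, hfl⟩ := exists_ne_zero_forall_smul_eq_zero
    (fun a ha => ht a (h'.mem a ha)) e heE he0
  obtain ⟨g, -, hgl, hgf⟩ := exists_prod_pow_smul_eq l'.length
    (fun l₁ h₁ hp => hE.of_generatesPrimary ht hl (by rw [h₁, hl']) h hp) t l' [] (by simp)
    (by simpa using h') f hf (by simp) hfl
  refine hf0 (hgf ▸ smul_eq_zero_of_mem_ofList hmem fun a ha => ?_)
  obtain ⟨b, hb, rfl⟩ := List.mem_map.1 ha
  exact hgl b (by simpa using hb)

end Monomial

/-! ### From almost regular to regular sequences -/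

section AlmostRegular

variable {B : Type*} [CommRing B]

lemma mem_ofList_map_const_iff {l : List B} {f : ℕ → B} :
    f ∈ Ideal.ofList (l.map fun b => (fun _ => b : ℕ → B)) ↔ ∀ n, f n ∈ Ideal.ofList l := by
  induction l generalizing f with
  | nil => simp [funext_iff]
  | cons b l ih =>
    simp only [List.map_cons, Ideal.ofList_cons, Submodule.mem_sup, Ideal.mem_span_singleton']
    constructor
    · rintro ⟨_, ⟨g, rfl⟩, h, hh, rfl⟩ n
      exact ⟨_, ⟨g n, rfl⟩, h n, ih.1 hh n, rfl⟩
    · intro H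
      choose y hy z hz hyz using H
      choose g hg using hy
      exact ⟨_, ⟨g, rfl⟩, z, ih.2 hz, funext fun n => by rw [← hyz n, ← hg n]; rfl⟩

/-- Gabber's construction: the ring of sequences in `B`, localized at the sequence `c`. A sequence
whose terms are killed by the corresponding terms of `c` becomes zero in this ring, while a finitely
generated ideal `I` of `B` generates the unit ideal only if some `k` satisfies `c n ^ k ∈ I` for
all `n`. -/
abbrev GabberLocalization (c : ℕ → B) : Type _ :=
  Localization (Submonoid.powers c)

/-- The diagonal map from `B` to its Gabber localization. -/
noncomputable def GabberLocalization.diagonal (c : ℕ → B) : B →+* GabberLocalization c :=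
  (algebraMap (ℕ → B) (GabberLocalization c)).comp (Pi.constRingHom ℕ B)

namespace GabberLocalization

variable {c : ℕ → B}

lemma algebraMap_mem_ofList_iff {l : List B} {f : ℕ → B} :
    algebraMap (ℕ → B) (GabberLocalization c) f ∈ Ideal.ofList (l.map (diagonal c)) ↔
      ∃ k : ℕ, ∀ n, c n ^ k * f n ∈ Ideal.ofList l := by
  have h : l.map (diagonal c) = (l.map fun b => (fun _ => b : ℕ → B)).map
      (algebraMap (ℕ → B) (GabberLocalization c)) := by
    rw [List.map_map]; rfl
  rw [h, ← Ideal.map_ofList,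
    IsLocalization.algebraMap_mem_map_algebraMap_iff (Submonoid.powers c)]
  constructor
  · rintro ⟨_, ⟨k, rfl⟩, hk⟩
    exact ⟨k, mem_ofList_map_const_iff.1 hk⟩
  · rintro ⟨k, hk⟩
    exact ⟨c ^ k, ⟨k, rfl⟩, mem_ofList_map_const_iff.2 hk⟩

lemma mem_ofList_of_mul_mem {l : List B} {a : B}
    (h : ∀ b : B, a * b ∈ Ideal.ofList l → ∀ n, c n * b ∈ Ideal.ofList l)
    {z : GabberLocalization c}
    (hz : diagonal c a * z ∈ Ideal.ofList (l.map (diagonal c))) :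
    z ∈ Ideal.ofList (l.map (diagonal c)) := by
  obtain ⟨f, s, rfl⟩ := IsLocalization.exists_mk'_eq (Submonoid.powers c) z
  have hs := IsLocalization.map_units (GabberLocalization c) s
  rw [← Ideal.unit_mul_mem_iff_mem _ hs, IsLocalization.mk'_spec']
  rw [← Ideal.unit_mul_mem_iff_mem _ hs, mul_left_comm, IsLocalization.mk'_spec'] at hz
  have hz' : algebraMap (ℕ → B) (GabberLocalization c) ((fun _ => a) * f) ∈
      Ideal.ofList (l.map (diagonal c)) := by
    rw [map_mul]; exact hz
  obtain ⟨k, hk⟩ := algebraMap_mem_ofList_iff.1 hz'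
  refine algebraMap_mem_ofList_iff.2 ⟨k + 1, fun n => ?_⟩
  have := h (c n ^ k * f n) (by rw [mul_left_comm]; exact hk n) n
  rwa [pow_succ', mul_assoc]

/-- If the terms of `c` kill `((l₁, …, lᵢ) : lᵢ₊₁) / (l₁, …, lᵢ)` for all `i`, and no power of
the sequence `c` lies in the ideal `(l)`, then `l` is a regular sequence on the Gabber
localization. -/
theorem isRegular {l : List B}
    (h : ∀ (i : ℕ) (hi : i < l.length) (b : B), l[i] * b ∈ Ideal.ofList (l.take i) →
      ∀ n, c n * b ∈ Ideal.ofList (l.take i))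
    (hc : ∀ k : ℕ, ∃ n, c n ^ k ∉ Ideal.ofList l) :
    RingTheory.Sequence.IsRegular (GabberLocalization c) (l.map (diagonal c)) where
  regular_mod_prev i hi := by
    rw [List.length_map] at hi
    rw [isSMulRegular_iff_right_eq_zero_of_smul]
    intro z hz
    obtain ⟨z, rfl⟩ := Submodule.Quotient.mk_surjective _ z
    rw [← Submodule.Quotient.mk_smul, Submodule.Quotient.mk_eq_zero, smul_eq_mul, Ideal.mul_top,
      ← List.map_take, List.getElem_map, smul_eq_mul] at hz
    rw [Submodule.Quotient.mk_eq_zero, smul_eq_mul, Ideal.mul_top, ← List.map_take]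
    exact mem_ofList_of_mul_mem (h i hi) hz
  top_ne_smul := by
    rw [smul_eq_mul, Ideal.mul_top]
    intro heq
    have h1 : algebraMap (ℕ → B) (GabberLocalization c) 1 ∈ Ideal.ofList (l.map (diagonal c)) := by
      rw [← heq]; trivial
    obtain ⟨k, hk⟩ := algebraMap_mem_ofList_iff.1 h1
    obtain ⟨n, hn⟩ := hc k
    exact hn (by simpa using hk n)

end GabberLocalization

/-- A sequence that is weakly regular on `B / aB`, together with `a` in front, satisfies the colon
conditions in `B` from the second element on. -/
lemma mem_ofList_take_of_isWeaklyRegular_quotient {a : B} {l : List B}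
    (h : RingTheory.Sequence.IsWeaklyRegular (B ⧸ Ideal.span {a}) l) {i : ℕ} (hi : i < l.length)
    {b : B} (hb : l[i] * b ∈ Ideal.ofList (a :: l.take i)) :
    b ∈ Ideal.ofList (a :: l.take i) := by
  have key : ∀ y : B, (Ideal.Quotient.mk (Ideal.span {a}) y ∈
      (Ideal.ofList (l.take i) • ⊤ : Submodule B (B ⧸ Ideal.span {a}))) ↔
      y ∈ Ideal.ofList (a :: l.take i) := by
    intro y
    have : (Ideal.ofList (l.take i) • ⊤ : Submodule B (B ⧸ Ideal.span {a})) =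
        Submodule.map (Submodule.mkQ (Ideal.span {a})) (Ideal.ofList (l.take i)) := by
      rw [← Submodule.range_mkQ, ← Submodule.map_top, ← Submodule.map_smul'', smul_eq_mul,
        Ideal.mul_top]
    rw [this, Ideal.ofList_cons, ← Submodule.comap_map_mkQ]
    rfl
  have hreg := h.regular_mod_prev i hi
  rw [isSMulRegular_iff_right_eq_zero_of_smul] at hreg
  have := hreg (Submodule.Quotient.mk (Ideal.Quotient.mk (Ideal.span {a}) b)) (by
    rw [← Submodule.Quotient.mk_smul, Submodule.Quotient.mk_eq_zero]
    exact (key (l[i] * b)).2 hb)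
  rw [Submodule.Quotient.mk_eq_zero] at this
  exact (key b).1 this

end AlmostRegular

/-! ### Rational powers in the absolute integral closure -/

section RationalPowers

variable {R : Type*} [CommRing R] [IsDomain R]

lemma AbsoluteIntegralClosure.dvd_of_pow_dvd_pow {x y : AbsoluteIntegralClosure R} {n : ℕ}
    (hn : n ≠ 0) (h : x ^ n ∣ y ^ n) : x ∣ y := by
  obtain ⟨z, hz⟩ := h
  by_cases hx : x = 0
  · rw [hx, zero_pow hn, zero_mul] at hz
    rw [pow_eq_zero_iff hn] at hz
    rw [hz]; exact dvd_zero _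
  have hx' : (x : AlgebraicClosure (FractionRing R)) ≠ 0 := by simpa using hx
  have hz' : (y : AlgebraicClosure (FractionRing R)) ^ n = x ^ n * z :=
    congrArg Subtype.val hz
  have hint : ((y : AlgebraicClosure (FractionRing R)) / x) ∈
      integralClosure R (AlgebraicClosure (FractionRing R)) := by
    refine IsIntegral.of_pow (Nat.pos_of_ne_zero hn) ?_
    rw [div_pow, hz', mul_div_cancel_left₀ _ (pow_ne_zero n hx')]
    exact z.2
  exact ⟨⟨_, hint⟩, Subtype.ext (by simp [mul_div_cancel₀ _ hx'])⟩

/-- Powers `a ^ δ` with small `δ` divide `a ^ ε` in the absolute integral closure, whatever choice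
of roots is made. -/
lemma AbsoluteIntegralClosure.exists_pow_dvd {a r : AbsoluteIntegralClosure R} {ε : ℚ} (hε : 0 < ε)
    (hr : IsRationalPower a ε r) (s : ℕ → AbsoluteIntegralClosure R)
    (hs : ∀ n : ℕ, IsRationalPower a (1 / (n + 1 : ℚ)) (s n)) (k : ℕ) : ∃ n, s n ^ k ∣ r := by
  -- For `n = k * ε.den` one has `k / (n + 1) < 1 / ε.den ≤ ε`; both sides are compared after
  -- raising them to a power that clears the denominators.
  refine ⟨k * ε.den, dvd_of_pow_dvd_pow (n := ε.den * (k * ε.den + 1))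
    (Nat.mul_ne_zero ε.den_nz (Nat.succ_ne_zero _)) ?_⟩
  have hsn : s (k * ε.den) ^ (k * ε.den + 1) = a := by
    have h := hs (k * ε.den)
    rw [IsRationalPower, show (1 / (((k * ε.den : ℕ) : ℚ) + 1)) =
      (((k * ε.den + 1 : ℕ) : ℚ))⁻¹ by push_cast; rw [one_div], Rat.inv_natCast_den_of_pos
      (Nat.succ_pos _), Rat.inv_natCast_num_of_pos (Nat.succ_pos _)] at h
    simpa using h
  rw [IsRationalPower] at hr
  have h₁ : (s (k * ε.den) ^ k) ^ (ε.den * (k * ε.den + 1)) = a ^ (k * ε.den) := by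
    rw [← pow_mul, show k * (ε.den * (k * ε.den + 1)) = (k * ε.den + 1) * (k * ε.den) by ring,
      pow_mul, hsn]
  have h₂ : r ^ (ε.den * (k * ε.den + 1)) = a ^ (ε.num.toNat * (k * ε.den + 1)) := by
    rw [pow_mul, hr, ← pow_mul]
  rw [h₁, h₂]
  refine pow_dvd_pow a ?_
  have : 0 < ε.num.toNat := by have := Rat.num_pos.2 hε; lia
  exact (Nat.le_succ _).trans (Nat.le_mul_of_pos_left _ this)

end RationalPowers

/-! ### Systems of parameters in integral extensions -/

section Integral

variable {A T : Type*} [CommRing A] [CommRing T] [Algebra A T] [Algebra.IsIntegral A T]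

lemma ringKrullDim_eq_of_isIntegral [FaithfulSMul A T] : ringKrullDim T = ringKrullDim A := by
  apply le_antisymm
  · exact Order.krullDim_le_of_strictMono (PrimeSpectrum.comap (algebraMap A T)) fun P Q h =>
      Ideal.IsIntegral.comap_lt_comap (I := P.asIdeal) (J := Q.asIdeal) h
  · refine iSup_le fun l => ?_
    have hbot : RingHom.ker (algebraMap A T) ≤ l.head.asIdeal := by
      rw [(RingHom.injective_iff_ker_eq_bot _).1 (FaithfulSMul.algebraMap_injective A T)]
      exact bot_le
    obtain ⟨Q, -, hQ, hQl⟩ := Ideal.exists_ideal_over_prime_of_isIntegral l.head.asIdeal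
      (⊥ : Ideal T) hbot
    have : Q.LiesOver l.head.asIdeal := ⟨hQl.symm⟩
    obtain ⟨L, hL, -⟩ := Ideal.exists_ltSeries_of_hasGoingUp l Q
    exact hL ▸ le_iSup (fun L : LTSeries (PrimeSpectrum T) => (L.length : WithBot ℕ∞)) L

open IsLocalRing

variable [IsLocalRing A] [IsLocalRing T]

lemma generatesPrimary_ofFn_iff_radical {d : ℕ} {x : Fin d → A} :
    GeneratesPrimary (List.ofFn x) ↔
      (Ideal.span (Set.range x)).radical = maximalIdeal A := by
  have hP : ∀ P : Ideal A, (∀ a ∈ List.ofFn x, a ∈ P) ↔ Ideal.span (Set.range x) ≤ P := by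
    intro P
    rw [Ideal.span_le, Set.range_subset_iff]
    simp
  constructor
  · intro h
    refine le_antisymm ((Ideal.IsPrime.radical_le_iff inferInstance).2 ((hP _).1 h.mem)) ?_
    rw [Ideal.radical_eq_sInf]
    refine le_sInf ?_
    rintro P ⟨hle, hPp⟩
    exact (h.eq_of_mem P hPp ((hP P).2 hle)).ge
  · intro h
    refine ⟨(hP _).2 (h ▸ Ideal.le_radical), fun P hPp hl => ?_⟩
    refine ((maximalIdeal.isMaximal A).eq_of_le hPp.ne_top ?_).symm
    rw [← h]
    exact (Ideal.IsPrime.radical_le_iff hPp).2 ((hP P).1 hl)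

lemma GeneratesPrimary.map_algebraMap [FaithfulSMul A T] {l : List A} (h : GeneratesPrimary l) :
    GeneratesPrimary (l.map (algebraMap A T)) where
  mem b hb := by
    obtain ⟨a, ha, rfl⟩ := List.mem_map.1 hb
    have := h.mem a ha
    rw [mem_maximalIdeal, mem_nonunits_iff] at this ⊢
    exact fun hu => this (isUnit_of_map_unit (algebraMap A T) a hu)
  eq_of_mem P hP hl := by
    have hc := h.eq_of_mem (P.comap (algebraMap A T)) inferInstance
      fun a ha => hl _ (List.mem_map.2 ⟨a, ha, rfl⟩)
    have : P.IsMaximal := Ideal.isMaximal_of_isIntegral_of_isMaximal_comap (R := A) P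
      (hc ▸ maximalIdeal.isMaximal A)
    exact eq_maximalIdeal this

lemma GeneratesPrimary.of_map_algebraMap [FaithfulSMul A T] {l : List A}
    (h : GeneratesPrimary (l.map (algebraMap A T))) : GeneratesPrimary l where
  mem a ha := by
    have := h.mem _ (List.mem_map.2 ⟨a, ha, rfl⟩)
    rw [mem_maximalIdeal, mem_nonunits_iff] at this ⊢
    exact fun hu => this (hu.map (algebraMap A T))
  eq_of_mem P hP hl := by
    have hbot : RingHom.ker (algebraMap A T) ≤ P := by
      rw [(RingHom.injective_iff_ker_eq_bot _).1 (FaithfulSMul.algebraMap_injective A T)]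
      exact bot_le
    obtain ⟨Q, -, hQ, rfl⟩ := Ideal.exists_ideal_over_prime_of_isIntegral P (⊥ : Ideal T) hbot
    have hQm := h.eq_of_mem Q hQ fun b hb => by
      obtain ⟨a, ha, rfl⟩ := List.mem_map.1 hb
      exact hl a ha
    have : Q.IsMaximal := hQm ▸ maximalIdeal.isMaximal T
    exact eq_maximalIdeal (Ideal.isMaximal_comap_of_isIntegral_of_isMaximal (R := A) Q)

end Integral

/-! ### Monomial Conjecture and big Cohen–Macaulay algebras -/

lemma Ideal.ofList_ofFn {A : Type*} [CommRing A] {d : ℕ} (x : Fin d → A) :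
    Ideal.ofList (List.ofFn x) = Ideal.span (Set.range x) :=
  congrArg Ideal.span (Set.ext fun a => by simp)

lemma RingTheory.Sequence.IsRegular.of_map_algebraMap {A S M : Type*} [CommRing A] [CommRing S]
    [Algebra A S] [AddCommGroup M] [Module A M] [Module S M] [IsScalarTower A S M] {l : List A}
    (h : IsRegular M (l.map (algebraMap A S))) : IsRegular M l :=
  ((AddEquiv.refl M).isRegular_congr <| List.forall₂_map_left_iff.mpr <|
    List.forall₂_same.mpr fun r _ => algebraMap_smul S r).1 h

/-- If a system of parameters of the Noetherian local ring `R` is a regular sequence on some module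
over the local integral extension `T` of `R`, then the Monomial Conjecture holds for `T`. The ring
`T` need not be Noetherian, but a relation that violates the conjecture descends to a module-finite
extension of `R` inside `T`. -/
theorem monomialConjectureHolds_of_isRegular {R T M : Type*} [CommRing R] [IsNoetherianRing R]
    [IsLocalRing R] [CommRing T] [IsLocalRing T] [Algebra R T] [Algebra.IsIntegral R T]
    [FaithfulSMul R T] {n : ℕ} {x : Fin n → R} (hx : IsSystemOfParameters x) [AddCommGroup M]
    [Module T M] (hM : RingTheory.Sequence.IsRegular M ((List.ofFn x).map (algebraMap R T))) :
    MonomialConjectureHolds T := by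
  intro d y hy t hmem
  obtain ⟨a, ha⟩ := Ideal.mem_span_range_iff_exists_fun.1 hmem
  let s : Set T := Set.range y ∪ Set.range a
  let A : Subalgebra R T := Algebra.adjoin R s
  have hs : s.Finite := (Set.finite_range y).union (Set.finite_range a)
  have : Module.Finite R A := by
    have := Algebra.FiniteType.adjoin_of_finite (R := R) hs
    have hint : Algebra.IsIntegral R A := ⟨fun z =>
      (isIntegral_algHom_iff A.val Subtype.val_injective).1 (Algebra.IsIntegral.isIntegral (z : T))⟩
    exact Algebra.IsIntegral.finite
  have : IsNoetherianRing A := IsNoetherianRing.of_finite R A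
  have : Algebra.IsIntegral A T := Algebra.IsIntegral.tower_top R
  have hAT : Function.Injective (algebraMap A T) := Subtype.val_injective
  have : FaithfulSMul A T := (faithfulSMul_iff_algebraMap_injective A T).2 hAT
  have hRT : Function.Injective (algebraMap R T) := FaithfulSMul.algebraMap_injective R T
  have : FaithfulSMul R A := (faithfulSMul_iff_algebraMap_injective R A).2 fun u v h =>
    hRT (congrArg (algebraMap A T) h)
  have : IsLocalRing A := (algebraMap A T).domain_isLocalRing
  let y' : Fin d → A := fun i => ⟨y i, Algebra.subset_adjoin (Or.inl ⟨i, rfl⟩)⟩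
  let a' : Fin d → A := fun i => ⟨a i, Algebra.subset_adjoin (Or.inr ⟨i, rfl⟩)⟩
  have hdim : ringKrullDim A = ringKrullDim R := ringKrullDim_eq_of_isIntegral
  have hdim' : ringKrullDim T = ringKrullDim A := ringKrullDim_eq_of_isIntegral
  have hheight := IsLocalRing.maximalIdeal_height_eq_ringKrullDim (R := A)
  have hX : GeneratesPrimary ((List.ofFn x).map (algebraMap R A)) :=
    (generatesPrimary_ofFn_iff_radical.2 hx.radical_eq).map_algebraMap
  have hY : GeneratesPrimary (List.ofFn y') := by
    refine GeneratesPrimary.of_map_algebraMap (T := T) ?_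
    rw [List.map_ofFn]
    exact generatesPrimary_ofFn_iff_radical.2 hy.radical_eq
  have hMA : RingTheory.Sequence.IsRegular M ((List.ofFn x).map (algebraMap R A)) := by
    refine RingTheory.Sequence.IsRegular.of_map_algebraMap (S := T) ?_
    rw [List.map_map]
    exact hM
  refine prod_pow_notMem_of_isRegular (l' := List.ofFn y') ?_ ?_ hX hY hMA t ?_
  · rw [List.length_map, List.length_ofFn]
    exact_mod_cast (hheight.trans (hdim.trans hx.dim_eq)).symm
  · rw [List.length_ofFn]
    exact_mod_cast (hheight.trans (hdim'.symm.trans hy.dim_eq)).symm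
  · rw [List.map_ofFn, List.map_ofFn, List.prod_ofFn, Ideal.ofList_ofFn]
    refine Ideal.mem_span_range_iff_exists_fun.2 ⟨a', Subtype.ext ?_⟩
    simpa [y', a'] using ha

/-- If the maximal ideal of `R` is the radical of `(x)`, then `(x)C ≠ C` implies `𝔪C ≠ C`. -/
lemma map_maximalIdeal_ne_top_of_radical_eq {R C : Type*} [CommRing R] [IsLocalRing R] [CommRing C]
    (f : R →+* C) {I : Ideal R} (hI : I.radical = IsLocalRing.maximalIdeal R)
    (h : I.map f ≠ ⊤) : (IsLocalRing.maximalIdeal R).map f ≠ ⊤ := by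
  obtain ⟨P, hP, hle⟩ := Ideal.exists_le_maximal _ h
  refine fun heq => hP.ne_top (top_le_iff.1 (heq ▸ Ideal.map_le_iff_le_comap.2 ?_))
  rw [← hI]
  exact (Ideal.IsPrime.radical_le_iff inferInstance).2 (Ideal.map_le_iff_le_comap.1 hle)

lemma AbsoluteIntegralClosure.algebraMap_injective {R : Type*} [CommRing R] [IsDomain R] :
    Function.Injective (algebraMap R (AbsoluteIntegralClosure R)) := by
  have h : Function.Injective (algebraMap R (AlgebraicClosure (FractionRing R))) := by
    rw [IsScalarTower.algebraMap_eq R (FractionRing R)]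
    exact (algebraMap (FractionRing R) _).injective.comp (IsFractionRing.injective R _)
  exact fun u v huv => h (congrArg Subtype.val huv)

theorem corollary6p1 {R : Type u} [CommRing R] [IsDomain R] [IsNoetherianRing R]
    [IsLocalRing R] [IsAdicComplete (IsLocalRing.maximalIdeal R) R]
    {p : ℕ} (hp : HasMixedCharacteristic R p)
    -- the system of parameters `p, x₂, …, x_d` of `R`, where `d = n + 1`
    {n : ℕ} (x : Fin n → R)
    (hx : IsSystemOfParameters (Fin.cons (p : R) x : Fin (n + 1) → R))
    {B : Type v} [CommRing B] [Algebra (AbsoluteIntegralClosure R) B]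
    -- (1) `(p, x₂, …, x_d) B ≠ B`
    (hB₁ : Ideal.span (Set.range fun i =>
      plusStructureMap R B ((Fin.cons (p : R) x : Fin (n + 1) → R) i)) ≠ ⊤)
    -- (2) `x₂, …, x_d` is a regular sequence on `B / pB`
    (hB₂ : RingTheory.Sequence.IsRegular (B ⧸ Ideal.span {(p : B)})
      (List.ofFn fun i => plusStructureMap R B (x i)))
    -- (3) `p` is not nilpotent in `B`, and `(0 :_B p)` is annihilated by all `p ^ ε`, `ε > 0`
    (hB₃ : ¬ IsNilpotent (p : B))
    (hB₄ : ∀ ε : ℚ, 0 < ε → ∃ r : AbsoluteIntegralClosure R,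
      IsRationalPower (p : AbsoluteIntegralClosure R) ε r ∧
        ∀ b : B, (p : B) * b = 0 → r • b = 0)
    -- `p ^ ε ∉ (p, x₂, …, x_d) B` for some rational `ε > 0`
    (hε : ∃ ε : ℚ, 0 < ε ∧ ∃ r : AbsoluteIntegralClosure R,
      IsRationalPower (p : AbsoluteIntegralClosure R) ε r ∧
        algebraMap (AbsoluteIntegralClosure R) B r ∉ Ideal.span (Set.range fun i =>
          plusStructureMap R B ((Fin.cons (p : R) x : Fin (n + 1) → R) i))) :
    (∃ (C : Type v) (_ : CommRing C) (_ : Algebra (AbsoluteIntegralClosure R) C),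
      Nonempty (B →ₐ[AbsoluteIntegralClosure R] C) ∧
        IsBigCohenMacaulay (Fin.cons (p : R) x : Fin (n + 1) → R) C) ∧
    ∀ (T : Subalgebra R (AbsoluteIntegralClosure R)) [IsLocalRing T],
      MonomialConjectureHolds T := by
  obtain ⟨ε, hε₀, r, hr, hrB⟩ := hε
  choose s hs hsB using fun k : ℕ => hB₄ (1 / (k + 1 : ℚ)) (by positivity)
  let c : ℕ → B := fun k => algebraMap (AbsoluteIntegralClosure R) B (s k)
  let C := GabberLocalization c
  have hmap : plusStructureMap R C =
      (GabberLocalization.diagonal c).comp (plusStructureMap R B) := rfl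
  have hlist :
      (List.ofFn fun i => plusStructureMap R B ((Fin.cons (p : R) x : Fin (n + 1) → R) i)) =
      (p : B) :: List.ofFn fun i => plusStructureMap R B (x i) := by
    simp [List.ofFn_succ]
  have hC : RingTheory.Sequence.IsRegular C
      (List.ofFn fun i => plusStructureMap R C ((Fin.cons (p : R) x : Fin (n + 1) → R) i)) := by
    have h : RingTheory.Sequence.IsRegular C
        (((p : B) :: List.ofFn fun i => plusStructureMap R B (x i)).map
          (GabberLocalization.diagonal c)) := by
      refine GabberLocalization.isRegular ?_ fun k => ?_
      · rintro (_ | i) hi b hb k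
        · simp only [List.getElem_cons_zero, List.take_zero, Ideal.ofList_nil, Ideal.mem_bot]
            at hb ⊢
          rw [← hsB k b hb, Algebra.smul_def]
        · rw [List.length_cons, Nat.add_lt_add_iff_right] at hi
          exact Ideal.mul_mem_left _ _
            (mem_ofList_take_of_isWeaklyRegular_quotient hB₂.toIsWeaklyRegular hi hb)
      · obtain ⟨m, z, hz⟩ := AbsoluteIntegralClosure.exists_pow_dvd hε₀ hr s hs k
        refine ⟨m, fun hm => hrB ?_⟩
        rw [← Ideal.ofList_ofFn, hlist, hz, map_mul, map_pow]
        exact Ideal.mul_mem_right _ _ hm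
    rw [← hlist, List.map_ofFn] at h
    exact h
  refine ⟨⟨C, inferInstance, inferInstance, ⟨?_⟩, hx, ?_, hC⟩, ?_⟩
  · exact (IsScalarTower.toAlgHom (AbsoluteIntegralClosure R) (ℕ → B) C).comp
      (Pi.constAlgHom (AbsoluteIntegralClosure R) ℕ B)
  · refine map_maximalIdeal_ne_top_of_radical_eq _ hx.radical_eq ?_
    have h := hC.top_ne_smul
    rw [smul_eq_mul, Ideal.mul_top, Ideal.ofList_ofFn] at h
    rw [Ideal.map_span, ← Set.range_comp]
    exact h.symm
  · intro T _
    have : Algebra.IsIntegral R T := ⟨fun z => (isIntegral_algHom_iff T.val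
      Subtype.val_injective).1 (Algebra.IsIntegral.isIntegral (z : AbsoluteIntegralClosure R))⟩
    have : FaithfulSMul R T := (faithfulSMul_iff_algebraMap_injective R T).2 fun u v h =>
      AbsoluteIntegralClosure.algebraMap_injective (congrArg T.val h)
    have : IsScalarTower T C C :=
      ⟨fun a b z => smul_mul_assoc (a : AbsoluteIntegralClosure R) b z⟩
    refine monomialConjectureHolds_of_isRegular hx (M := C)
      (RingTheory.Sequence.IsRegular.of_map_algebraMap (S := C) ?_)
    rw [List.map_map, List.map_ofFn]
    exact hC
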